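/- Let $\Gamma$ be an infinite group generated by a finite set $S$, let $e$ be its identity element, and let $p>1$ be a real number. **Reduced cohomology.** For $f\colon\Gamma\to\mathbb R$ put $I_p(f,\Gamma)=\sum_{x\in\Gamma}\sum_{s\in S}|f(xs^{-1})-f(x)|^p$. Let $D_p(\Gamma)$ be the vector space of all $f\colon\Gamma\to\mathbb R$ with $I_p(f,\Gamma)<\infty$, with the norm $\|f\|_{D_p}=\left(I_p(f,\Gamma)+|f(e)|^p\right)^{1/p}$. The first reduced $\ell^p$-cohomology space of $\Gamma$ is $$\bar H^1_{(p)}(\Gamma)=D_p(\Gamma)\big/\overline{\ell^p(\Gamma)+\mathbb R},$$ where $\ell^p(\Gamma)$ is the space of real functions on $\Gamma$ with $\sum_{x}|f(x)|^p<\infty$, $\mathbb R$ is the space of constant functions, and the closure is taken in $D_p(\Gamma)$. **The $p$-harmonic boundary.** Let $G$ be the Cayley graph of $\Gamma$: its vertices are the elements of $\Gamma$, and distinct $x_1,x_2$ are joined by an edge if and only if $x_1=x_2s^{\pm1}$ for some $s\in S$. Let $N_x$ be the set of neighbors of $x$, put $I_p(f,G)=\sum_{x\in\Gamma}\sum_{y\in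 N_x}|f(y)-f(x)|^p$, and let $D_p(G)$ be the space of all $f\colon\Gamma\to\mathbb R$ with $I_p(f,G)<\infty$, with the norm $\left(I_p(f,G)+|f(e)|^p\right)^{1/p}$. Let $BD_p(G)$ be the algebra, under pointwise operations, of bounded functions in $D_p(G)$; it is a commutative Banach algebra under the norm $I_p(f,G)^{1/p}+\sup_{\Gamma}|f|$. Let $\mathrm{Sp}(BD_p(G))$ be its spectrum, that is, the set of all nonzero homomorphisms of real algebras $\tau\colon BD_p(G)\to\mathbb C$; each $x\in\Gamma$ gives the element $i(x)\colon f\mapsto f(x)$ of it. Let $B$ be the set of bounded functions that lie in the closure in $D_p(G)$ of the finitely supported functions $\Gamma\to\mathbb R$. The $p$-harmonic boundary of $\Gamma$ is $$\partial_p(\Gamma)=\{\tau\in \mathrm{Sp}(BD_p(G))\setminus i(\Gamma)\;:\;\tau(f)=0\text{ for all }f\in B\}.$$ **Theorem.** $\bar H^1_{(p)}(\Gamma)\neq 0$ if and only if $\#(\partial_p(\Gamma))>1$. -/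

import Mathlib

namespace PHarmonic

/-! ### Dirichlet sums

A neighbour system on `V` assigns to each `x : V` a family `N x : ι x → V` of neighbours.
It is used for the neighbours of a vertex in a graph, and for the points `x * s⁻¹`, `s ∈ S`,
in a group with generating set `S`. -/

section Dirichlet

variable {V : Type*} {ι : V → Type*}

/-- The summand `|f y - f x| ^ p` of the Dirichlet sum, for the neighbour `y = N x i` of `x`. -/
noncomputable def energyTerm (N : ∀ x, ι x → V) (p : ℝ) (f : V → ℝ) (e : Σ x, ι x) : ℝ :=
  |f (N e.1 e.2) - f e.1| ^ p

/-- The `p`-Dirichlet sum `I_p(f, V)`, the sum over all `x` and all neighbours `y` of `x`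
of `|f y - f x| ^ p`. It is only meaningful for `p`-Dirichlet finite `f`. -/
noncomputable def dirichletSum (N : ∀ x, ι x → V) (p : ℝ) (f : V → ℝ) : ℝ :=
  ∑' e : Σ x, ι x, energyTerm N p f e

/-- `f` is `p`-Dirichlet finite: the (nonnegative) series `I_p(f, V)` converges. -/
def DirichletFinite (N : ∀ x, ι x → V) (p : ℝ) (f : V → ℝ) : Prop :=
  Summable (energyTerm N p f)

/-- `(I_p(f, V) + |f o| ^ p) ^ (1 / p)`. -/
noncomputable def dpNorm (N : ∀ x, ι x → V) (p : ℝ) (o : V) (f : V → ℝ) : ℝ :=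
  (dirichletSum N p f + |f o| ^ p) ^ (1 / p)

variable {N : ∀ x, ι x → V} {p : ℝ}

lemma energyTerm_nonneg (f : V → ℝ) (e : Σ x, ι x) : 0 ≤ energyTerm N p f e :=
  Real.rpow_nonneg (abs_nonneg _) _

lemma dirichletSum_nonneg (f : V → ℝ) : 0 ≤ dirichletSum N p f :=
  tsum_nonneg (energyTerm_nonneg f)

lemma energyTerm_const (hp : 1 < p) (c : ℝ) : energyTerm N p (fun _ => c) = 0 := by
  funext e
  simp [energyTerm, Real.zero_rpow (by linarith : p ≠ 0)]

lemma dirichletFinite_const (hp : 1 < p) (c : ℝ) : DirichletFinite N p (fun _ => c) := by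
  unfold DirichletFinite
  rw [energyTerm_const hp]
  exact summable_zero

lemma energyTerm_smul (c : ℝ) (f : V → ℝ) (e : Σ x, ι x) :
    energyTerm N p (c • f) e = |c| ^ p * energyTerm N p f e := by
  simp only [energyTerm, Pi.smul_apply, smul_eq_mul]
  rw [← mul_sub, abs_mul, Real.mul_rpow (abs_nonneg _) (abs_nonneg _)]

lemma DirichletFinite.smul {f : V → ℝ} (hf : DirichletFinite N p f) (c : ℝ) :
    DirichletFinite N p (c • f) := by
  unfold DirichletFinite
  rw [funext (energyTerm_smul c f)]
  exact Summable.mul_left _ hf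

lemma minkowski_summable (hp : 1 < p) {α : Type*} {a b : α → ℝ}
    (ha : ∀ i, 0 ≤ a i) (hb : ∀ i, 0 ≤ b i)
    (hsa : Summable fun i => a i ^ p) (hsb : Summable fun i => b i ^ p)
    {c : α → ℝ} (hc : ∀ i, 0 ≤ c i) (hcab : ∀ i, c i ≤ a i + b i) :
    Summable fun i => c i ^ p :=
  Summable.of_nonneg_of_le (fun i => Real.rpow_nonneg (hc i) _)
    (fun i => Real.rpow_le_rpow (hc i) (hcab i) (by linarith))
    (Real.summable_Lp_add_of_nonneg hp.le ha hb hsa hsb)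

lemma DirichletFinite.add (hp : 1 < p) {f g : V → ℝ} (hf : DirichletFinite N p f)
    (hg : DirichletFinite N p g) : DirichletFinite N p (f + g) := by
  refine minkowski_summable hp (fun _ => abs_nonneg _) (fun _ => abs_nonneg _) hf hg
    (fun _ => abs_nonneg _) (fun e => ?_)
  simp only [Pi.add_apply]
  rw [add_sub_add_comm]
  exact abs_add_le _ _

lemma DirichletFinite.mul (hp : 1 < p) {f g : V → ℝ} (hf : DirichletFinite N p f)
    (hg : DirichletFinite N p g) {A B : ℝ} (hA : ∀ x, |f x| ≤ A) (hB : ∀ x, |g x| ≤ B) :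
    DirichletFinite N p (f * g) := by
  refine minkowski_summable hp (fun _ => abs_nonneg _) (fun _ => abs_nonneg _)
    (hf.smul B) (hg.smul A) (fun _ => abs_nonneg _) (fun e => ?_)
  simp only [Pi.mul_apply, Pi.smul_apply, smul_eq_mul]
  rw [← mul_sub, ← mul_sub, abs_mul, abs_mul]
  have h1 : f (N e.1 e.2) * g (N e.1 e.2) - f e.1 * g e.1
      = g (N e.1 e.2) * (f (N e.1 e.2) - f e.1) + f e.1 * (g (N e.1 e.2) - g e.1) := by ring
  rw [h1]
  refine (abs_add_le _ _).trans ?_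
  rw [abs_mul, abs_mul]
  exact add_le_add
    (mul_le_mul_of_nonneg_right ((hB _).trans (le_abs_self _)) (abs_nonneg _))
    (mul_le_mul_of_nonneg_right ((hA _).trans (le_abs_self _)) (abs_nonneg _))

lemma dpNorm_eq_tsum (o : V) {f : V → ℝ} (hf : DirichletFinite N p f) :
    (Summable fun j : (Σ x, ι x) ⊕ Unit =>
      (Sum.elim (fun e => |f (N e.1 e.2) - f e.1|) (fun _ => |f o|) j : ℝ) ^ p) ∧
    dpNorm N p o f = (∑' j : (Σ x, ι x) ⊕ Unit,
      (Sum.elim (fun e => |f (N e.1 e.2) - f e.1|) (fun _ => |f o|) j : ℝ) ^ p) ^ (1 / p) := by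
  have h : HasSum (fun j : (Σ x, ι x) ⊕ Unit =>
      (Sum.elim (fun e => |f (N e.1 e.2) - f e.1|) (fun _ => |f o|) j : ℝ) ^ p)
      (dirichletSum N p f + |f o| ^ p) :=
    HasSum.sum hf.hasSum (hasSum_unique (fun _ : Unit => |f o| ^ p))
  exact ⟨h.summable, by rw [h.tsum_eq]; rfl⟩

lemma dpNorm_add_le (hp : 1 < p) (o : V) {f g : V → ℝ} (hf : DirichletFinite N p f)
    (hg : DirichletFinite N p g) :
    dpNorm N p o (f + g) ≤ dpNorm N p o f + dpNorm N p o g := by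
  obtain ⟨sf, ef⟩ := dpNorm_eq_tsum o hf
  obtain ⟨sg, eg⟩ := dpNorm_eq_tsum o hg
  obtain ⟨sfg, efg⟩ := dpNorm_eq_tsum o (hf.add hp hg)
  have nn : ∀ (h : V → ℝ) (j : (Σ x, ι x) ⊕ Unit),
      0 ≤ (Sum.elim (fun e => |h (N e.1 e.2) - h e.1|) (fun _ => |h o|) j : ℝ) := by
    rintro h (e | _) <;> exact abs_nonneg _
  obtain ⟨s, hs⟩ := Real.Lp_add_le_tsum_of_nonneg hp.le (nn f) (nn g) sf sg
  rw [ef, eg, efg]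
  refine le_trans (Real.rpow_le_rpow
    (tsum_nonneg fun j => Real.rpow_nonneg (nn _ j) _) ?_ (by positivity)) hs
  refine sfg.tsum_le_tsum (fun j => Real.rpow_le_rpow (nn _ j) ?_ (by linarith)) s
  rcases j with e | _
  · simp only [Sum.elim_inl, Pi.add_apply]
    rw [add_sub_add_comm]
    exact abs_add_le _ _
  · exact abs_add_le _ _

lemma dpNorm_smul (hp : 1 < p) (o : V) (c : ℝ) (f : V → ℝ) :
    dpNorm N p o (c • f) = |c| * dpNorm N p o f := by
  have h0 : p ≠ 0 := by linarith
  unfold dpNorm dirichletSum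
  rw [funext (energyTerm_smul c f), tsum_mul_left, Pi.smul_apply, smul_eq_mul, abs_mul,
    Real.mul_rpow (abs_nonneg _) (abs_nonneg _), ← mul_add,
    Real.mul_rpow (by positivity)
      (add_nonneg (tsum_nonneg (energyTerm_nonneg f)) (by positivity)),
    one_div, Real.rpow_rpow_inv (abs_nonneg _) h0]

variable (N)

/-- The vector space `D_p` of `p`-Dirichlet finite real functions on `V`. -/
def Dp (hp : 1 < p) : Submodule ℝ (V → ℝ) where
  carrier := {f | DirichletFinite N p f}
  add_mem' hf hg := DirichletFinite.add hp hf hg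
  zero_mem' := dirichletFinite_const hp 0
  smul_mem' c _ hf := DirichletFinite.smul hf c

/-- The algebra `BD_p` of bounded `p`-Dirichlet finite real functions on `V`, with pointwise
operations. -/
def BDp (hp : 1 < p) : Subalgebra ℝ (V → ℝ) where
  carrier := {f | DirichletFinite N p f ∧ ∃ C : ℝ, ∀ x, |f x| ≤ C}
  add_mem' := by
    rintro f g ⟨hf, A, hA⟩ ⟨hg, B, hB⟩
    exact ⟨hf.add hp hg, A + B, fun x => (abs_add_le _ _).trans (add_le_add (hA x) (hB x))⟩
  mul_mem' := by
    rintro f g ⟨hf, A, hA⟩ ⟨hg, B, hB⟩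
    refine ⟨hf.mul hp hg hA hB, A * B, fun x => ?_⟩
    rw [Pi.mul_apply, abs_mul]
    exact mul_le_mul (hA x) (hB x) (abs_nonneg _) ((abs_nonneg _).trans (hA x))
  algebraMap_mem' c := ⟨dirichletFinite_const hp c, |c|, fun _ => le_rfl⟩

/-- `D_p` with the topology given by the norm `(I_p(f, V) + |f o| ^ p) ^ (1 / p)` (and not the
topology of pointwise convergence that it inherits from `V → ℝ`). -/
def DpSpace (hp : 1 < p) (_o : V) : Type _ := Dp N hp

namespace DpSpace

variable (hp : 1 < p) (o : V)

noncomputable instance : AddCommGroup (DpSpace N hp o) :=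
  inferInstanceAs (AddCommGroup (Dp N hp))

noncomputable instance : Module ℝ (DpSpace N hp o) :=
  inferInstanceAs (Module ℝ (Dp N hp))

/-- The underlying function of an element of `D_p`, as a linear map. -/
def toFun : DpSpace N hp o →ₗ[ℝ] (V → ℝ) := (Dp N hp).subtype

/-- The norm of `D_p`. It is stated as a seminorm, since its definiteness depends on the
connectedness of the neighbour system. -/
noncomputable def seminorm : Seminorm ℝ (DpSpace N hp o) :=
  Seminorm.of (fun f => dpNorm N p o (toFun N hp o f))
    (fun f g => by
      rw [map_add]
      exact dpNorm_add_le hp o f.2 g.2)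
    (fun c f => by
      rw [map_smul, Real.norm_eq_abs]
      exact dpNorm_smul hp o c _)

noncomputable instance : SeminormedAddCommGroup (DpSpace N hp o) :=
  (seminorm N hp o).toAddGroupSeminorm.toSeminormedAddCommGroup

lemma norm_def (f : DpSpace N hp o) : ‖f‖ = dpNorm N p o (toFun N hp o f) := rfl

noncomputable instance : NormedSpace ℝ (DpSpace N hp o) where
  norm_smul_le c f := (map_smul_eq_mul (seminorm N hp o) c f).le

end DpSpace

end Dirichlet

/-! ### The `p`-harmonic boundary of a graph -/

section Boundary

variable {V : Type*} (G : SimpleGraph V) {p : ℝ} (hp : 1 < p)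

/-- The neighbour system of a graph: the neighbours of `x` are the elements of `N_x`. -/
def graphNbr (x : V) : G.neighborSet x → V := Subtype.val

/-- The spectrum of `BD_p(G)`: the set of characters, i.e. of nonzero homomorphisms of real
algebras `BD_p(G) → ℂ`. As `BD_p(G)` has a unit and `ℂ` is a field, a homomorphism is nonzero if
and only if it is unital. -/
abbrev Spectrum : Type _ := BDp (graphNbr G) hp →ₐ[ℝ] ℂ

/-- The character `f ↦ f x` given by a vertex `x`. -/
noncomputable def evalChar (x : V) : Spectrum G hp :=
  Complex.ofRealAm.comp ((Pi.evalAlgHom ℝ (fun _ : V => ℝ) x).comp (BDp (graphNbr G) hp).val)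

/-- The `p`-Royden boundary: the characters that are not given by a vertex. -/
def roydenBoundary : Set (Spectrum G hp) := (Set.range (evalChar G hp))ᶜ

/-- The closure in `D_p(G)` of the set of finitely supported real functions on `V`. -/
def finSuppClosure (o : V) : Set (DpSpace (graphNbr G) hp o) :=
  closure {u | (Function.support (DpSpace.toFun (graphNbr G) hp o u)).Finite}

/-- The set of bounded functions that lie in the closure in `D_p(G)` of the finitely supported
functions. -/
def boundedFinSuppClosure (o : V) : Set (BDp (graphNbr G) hp) :=
  {f | ∃ u ∈ finSuppClosure G hp o, DpSpace.toFun (graphNbr G) hp o u = f.1}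

/-- The `p`-harmonic boundary `∂_p(G)`: the points of the `p`-Royden boundary at which the
Gelfand transform of every bounded function in the `D_p`-closure of the finitely supported
functions vanishes. -/
def harmonicBoundary (o : V) : Set (Spectrum G hp) :=
  {τ | τ ∈ roydenBoundary G hp ∧ ∀ f ∈ boundedFinSuppClosure G hp o, τ f = 0}

end Boundary

/-! ### The first reduced `ℓ^p`-cohomology of a group -/

section Cohomology

variable {Γ : Type*} [Group Γ] (S : Set Γ) {p : ℝ} (hp : 1 < p)

/-- The neighbour system of a group with generating set `S`: the neighbours of `x` are the
points `x * s⁻¹` for `s ∈ S`, so that `I_p(f, Γ)` is the sum over `x ∈ Γ` and `s ∈ S` of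
`|f (x * s⁻¹) - f x| ^ p`. -/
def groupNbr (x : Γ) (s : S) : Γ := x * (s : Γ)⁻¹

/-- The space `D_p(Γ)`, normed by `(I_p(f, Γ) + |f e| ^ p) ^ (1 / p)`. -/
abbrev DpGroup : Type _ := DpSpace (groupNbr S) hp (1 : Γ)

/-- `ℓ^p(Γ)`, as a subspace of `D_p(Γ)`. -/
noncomputable def lpSubmodule : Submodule ℝ (DpGroup S hp) where
  carrier := {f | Memℓp (DpSpace.toFun (groupNbr S) hp 1 f) (ENNReal.ofReal p)}
  add_mem' {f g} hf hg := by
    rw [Set.mem_ofPred_eq, map_add]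
    exact Memℓp.add hf hg
  zero_mem' := by
    rw [Set.mem_ofPred_eq, map_zero]
    exact zero_memℓp
  smul_mem' c f hf := by
    rw [Set.mem_ofPred_eq, map_smul]
    exact Memℓp.const_smul hf c

/-- The constant functions, as a subspace of `D_p(Γ)`. -/
noncomputable def constSubmodule : Submodule ℝ (DpGroup S hp) :=
  (Submodule.span ℝ {(fun _ => 1 : Γ → ℝ)}).comap (DpSpace.toFun (groupNbr S) hp 1)

/-- The first reduced `ℓ^p`-cohomology space of `Γ`: the quotient of `D_p(Γ)` by the closure of
`ℓ^p(Γ) + ℝ`. -/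
abbrev ReducedCohomology : Type _ :=
  DpGroup S hp ⧸ (lpSubmodule S hp ⊔ constSubmodule S hp).topologicalClosure

end Cohomology

end PHarmonic

open Filter Topology
-- Convergence in `D_p` and control of point values
namespace PHarmonic

/-! Let `F` be the closure in `D_p(G)` of the finitely supported functions. The spaces `D_p(Γ)` and
`D_p(G)` have the same elements and equivalent norms, and `ℓ^p(Γ)` lies in `F`, because cutting off
the small values of an `ℓ^p` function leaves a finitely supported one. So the reduced cohomology
vanishes if and only if `F + ℝ` is all of `D_p(G)`.

If `F + ℝ = D_p(G)`, every bounded `f` is a constant `c` plus an element of `B`, so all points of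
the boundary take the value `c` at `f`, and there is at most one such point
(`encard_harmonicBoundary_le_one`).

If `F + ℝ ≠ D_p(G)`, some bounded `f` lies outside `F + ℝ`, because bounded functions are dense and
`F + ℝ` is closed. Since `B` is a proper ideal, `exists_character` gives a character `τ₀` that kills
it; put `g = f - τ₀ f`, which is not in `F`. Some soft threshold `s` of `g` at a level `t` is still
not in `F`. The tent function `k = 1 - min(|g|, t)/t` satisfies `k s = 0`, so `B + (k)` is proper:
`1 = b + a k` would give `s = s b ∈ B`. A character `τ₁` obtained from `B + (k)` differs from `τ₀`:
where `g` tends to `0`, `k` tends to `1`, not `0`. Both lie in the boundary, since point evaluations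
do not kill `B` (`one_lt_encard_harmonicBoundary`). -/

lemma summable_rpow_of_le_add {p : ℝ} (hp : 1 < p) {α : Type*} {a b c : α → ℝ}
    (ha : ∀ i, 0 ≤ a i) (hb : ∀ i, 0 ≤ b i) (hc : ∀ i, 0 ≤ c i)
    (hsb : Summable fun i => b i ^ p) (hsc : Summable fun i => c i ^ p)
    (h : ∀ i, a i ≤ b i + c i) :
    (Summable fun i => a i ^ p) ∧
      (∑' i, a i ^ p) ^ (1 / p) ≤ (∑' i, b i ^ p) ^ (1 / p) + (∑' i, c i ^ p) ^ (1 / p) := by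
  have hs := minkowski_summable hp hb hc hsb hsc ha h
  obtain ⟨s, hle⟩ := Real.Lp_add_le_tsum_of_nonneg hp.le hb hc hsb hsc
  refine ⟨hs, le_trans (Real.rpow_le_rpow (tsum_nonneg fun i => Real.rpow_nonneg (ha i) _) ?_
    (by positivity)) hle⟩
  exact hs.tsum_le_tsum (fun i => Real.rpow_le_rpow (ha i) (h i) (by linarith)) s

/-- A dominated convergence theorem in which the dominating family is allowed to vary by a
family tending to `0` in `ℓ^p`. -/
lemma tendsto_tsum_rpow_zero {p : ℝ} (hp : 1 < p) {α : Type*} {a b : ℕ → α → ℝ} {c : α → ℝ}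
    (ha : ∀ n i, 0 ≤ a n i) (hb : ∀ n i, 0 ≤ b n i) (hc : ∀ i, 0 ≤ c i)
    (hsb : ∀ n, Summable fun i => b n i ^ p)
    (hb0 : Tendsto (fun n => ∑' i, b n i ^ p) atTop (𝓝 0))
    (hsc : Summable fun i => c i ^ p) (h : ∀ n i, a n i ≤ b n i + c i)
    (ha0 : ∀ i, Tendsto (fun n => a n i) atTop (𝓝 0)) :
    Tendsto (fun n => ∑' i, a n i ^ p) atTop (𝓝 0) := by
  have hp0 : 0 < p := by linarith
  -- Split `a ≤ b + min a c`: ordinary dominated convergence handles the minimum, and `b` tends to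
  -- `0` in `ℓ^p` by assumption.
  have hm : ∀ n i, 0 ≤ min (a n i) (c i) := fun n i => le_min (ha n i) (hc i)
  have hmc : ∀ n i, min (a n i) (c i) ^ p ≤ c i ^ p := fun n i =>
    Real.rpow_le_rpow (hm n i) (min_le_right _ _) hp0.le
  have hsm : ∀ n, Summable fun i => min (a n i) (c i) ^ p := fun n =>
    Summable.of_nonneg_of_le (fun i => Real.rpow_nonneg (hm n i) _) (hmc n) hsc
  have hm0 : Tendsto (fun n => ∑' i, min (a n i) (c i) ^ p) atTop (𝓝 0) := by
    have := tendsto_tsum_of_dominated_convergence (𝓕 := atTop)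
      (f := fun n i => min (a n i) (c i) ^ p) (g := fun _ => 0) hsc
      (fun i => by
        have h1 : Tendsto (fun n => min (a n i) (c i)) atTop (𝓝 0) :=
          squeeze_zero (fun n => hm n i) (fun n => min_le_left _ _) (ha0 i)
        simpa [Real.zero_rpow hp0.ne'] using h1.rpow_const (Or.inr hp0.le))
      (Eventually.of_forall fun n i => by
        rw [Real.norm_of_nonneg (Real.rpow_nonneg (hm n i) _)]
        exact hmc n i)
    simpa using this
  have key := fun n => (summable_rpow_of_le_add hp (ha n) (hb n) (hm n) (hsb n) (hsm n)
    (fun i => by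
      rcases le_total (a n i) (c i) with h1 | h1
      · rw [min_eq_left h1]; linarith [hb n i]
      · rw [min_eq_right h1]; exact h n i)).2
  have hroot : Tendsto (fun n => (∑' i, a n i ^ p) ^ (1 / p)) atTop (𝓝 0) := by
    refine squeeze_zero (fun n => Real.rpow_nonneg
      (tsum_nonneg fun i => Real.rpow_nonneg (ha n i) _) _) key ?_
    have h1 := hb0.rpow_const (p := 1 / p) (Or.inr (by positivity))
    have h2 := hm0.rpow_const (p := 1 / p) (Or.inr (by positivity))
    have h3 := h1.add h2
    rwa [Real.zero_rpow (by positivity), add_zero] at h3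
  have h4 := hroot.rpow_const (p := p) (Or.inr hp0.le)
  rw [Real.zero_rpow hp0.ne'] at h4
  refine h4.congr fun n => ?_
  rw [one_div, Real.rpow_inv_rpow (tsum_nonneg fun i => Real.rpow_nonneg (ha n i) _) hp0.ne']

section

variable {V : Type*} {ι : V → Type*} {N : ∀ x, ι x → V} {p : ℝ}

lemma abs_le_dpNorm (hp : 1 < p) (o : V) {f : V → ℝ} : |f o| ≤ dpNorm N p o f := by
  have h0 : p ≠ 0 := by linarith
  calc |f o| = (|f o| ^ p) ^ (1 / p) := by rw [one_div, Real.rpow_rpow_inv (abs_nonneg _) h0]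
    _ ≤ _ := Real.rpow_le_rpow (by positivity)
      (le_add_of_nonneg_left (dirichletSum_nonneg f)) (by positivity)

lemma dirichletSum_le_dpNorm_rpow (hp : 1 < p) (o : V) {f : V → ℝ} :
    dirichletSum N p f ≤ dpNorm N p o f ^ p := by
  have h0 : p ≠ 0 := by linarith
  rw [dpNorm, one_div, Real.rpow_inv_rpow
    (add_nonneg (dirichletSum_nonneg f) (by positivity)) h0]
  exact le_add_of_nonneg_right (by positivity)

lemma abs_sub_le_dpNorm (hp : 1 < p) (o : V) {f : V → ℝ} (hf : DirichletFinite N p f)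
    (e : Σ x, ι x) : |f (N e.1 e.2) - f e.1| ≤ dpNorm N p o f := by
  have h0 : 0 < p := by linarith
  refine (Real.rpow_le_rpow_iff (abs_nonneg _) ((abs_nonneg _).trans (abs_le_dpNorm hp o)) h0).1 ?_
  exact (hf.le_tsum e fun _ _ => energyTerm_nonneg f _).trans (dirichletSum_le_dpNorm_rpow hp o)

/-- Meant for Lipschitz functions of `f`: truncations, thresholds, tent functions, and inverses away
from zero. -/
lemma DirichletFinite.of_abs_sub_le (hp : 1 < p) {f g : V → ℝ} (hf : DirichletFinite N p f)
    {L : ℝ} (h : ∀ x y, |g x - g y| ≤ L * |f x - f y|) : DirichletFinite N p g := by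
  refine minkowski_summable hp (fun _ => abs_nonneg _) (fun _ => abs_nonneg _) (hf.smul L)
    (dirichletFinite_const (N := N) hp 0) (fun _ => abs_nonneg _) fun e => (h _ _).trans ?_
  simp only [Pi.smul_apply, smul_eq_mul, sub_self, abs_zero, add_zero, ← mul_sub, abs_mul]
  exact mul_le_mul_of_nonneg_right (le_abs_self _) (abs_nonneg _)

/-- Values are controlled by the `D_p` norm along a connected neighbour system. -/
lemma exists_abs_le_mul_dpNorm (hp : 1 < p) (o : V) {x : V}
    (hx : Relation.ReflTransGen (fun x y => ∃ i, N x i = y) o x) :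
    ∃ C : ℝ, ∀ f : V → ℝ, DirichletFinite N p f → |f x| ≤ C * dpNorm N p o f := by
  induction hx with
  | refl => exact ⟨1, fun f _ => by simpa using abs_le_dpNorm hp o⟩
  | @tail y z _ hz ih =>
    obtain ⟨C, hC⟩ := ih
    obtain ⟨i, rfl⟩ := hz
    refine ⟨C + 1, fun f hf => ?_⟩
    have h1 := hC f hf
    have h2 := abs_sub_le_dpNorm hp o hf ⟨y, i⟩
    have h3 := abs_add_le (f (N y i) - f y) (f y)
    rw [sub_add_cancel] at h3
    simp only at h2
    linarith

namespace DpSpace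

variable (N) in
/-- The element of `D_p` given by a `p`-Dirichlet finite function. -/
def mk (hp : 1 < p) (o : V) (f : V → ℝ) (hf : DirichletFinite N p f) : DpSpace N hp o :=
  (⟨f, hf⟩ : Dp N hp)

variable {hp : 1 < p} {o : V}

@[simp] lemma toFun_mk {f : V → ℝ} (hf : DirichletFinite N p f) :
    toFun N hp o (mk N hp o f hf) = f := rfl

lemma dirichletFinite (F : DpSpace N hp o) : DirichletFinite N p (toFun N hp o F) := F.2

lemma toFun_injective : Function.Injective (toFun N hp o) := Subtype.val_injective

lemma tendsto_apply {v : ℕ → DpSpace N hp o} {F : DpSpace N hp o} (h : Tendsto v atTop (𝓝 F))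
    {x : V} (hx : Relation.ReflTransGen (fun x y => ∃ i, N x i = y) o x) :
    Tendsto (fun n => toFun N hp o (v n) x) atTop (𝓝 (toFun N hp o F x)) := by
  obtain ⟨C, hC⟩ := exists_abs_le_mul_dpNorm hp o hx
  rw [tendsto_iff_norm_sub_tendsto_zero] at h ⊢
  refine squeeze_zero (fun _ => norm_nonneg _) (fun n => ?_) (by simpa using h.const_mul C)
  have := hC _ (v n - F).dirichletFinite
  rwa [map_sub] at this

/-- Pointwise convergence together with a bound on the gradients yields convergence in `D_p`. -/
lemma tendsto_of_pointwise {v w : ℕ → DpSpace N hp o} {F : DpSpace N hp o}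
    {c : (Σ x, ι x) → ℝ} (hc : ∀ e, 0 ≤ c e) (hsc : Summable fun e => c e ^ p)
    (hw : Tendsto w atTop (𝓝 0))
    (hv : ∀ x, Tendsto (fun n => toFun N hp o (v n) x) atTop (𝓝 (toFun N hp o F x)))
    (hvw : ∀ n (e : Σ x, ι x),
      |toFun N hp o (v n) (N e.1 e.2) - toFun N hp o (v n) e.1| ≤
        |toFun N hp o (w n) (N e.1 e.2) - toFun N hp o (w n) e.1| + c e) :
    Tendsto v atTop (𝓝 F) := by
  have hp0 : 0 < p := by linarith
  rw [tendsto_iff_norm_sub_tendsto_zero]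
  have hv0 : ∀ x, Tendsto (fun n => toFun N hp o (v n - F) x) atTop (𝓝 0) := fun x => by
    have h1 := (hv x).sub_const (toFun N hp o F x)
    rw [sub_self] at h1
    exact h1
  set a : ℕ → (Σ x, ι x) → ℝ := fun n e =>
    |toFun N hp o (v n - F) (N e.1 e.2) - toFun N hp o (v n - F) e.1| with ha
  set b : ℕ → (Σ x, ι x) → ℝ := fun n e =>
    |toFun N hp o (w n) (N e.1 e.2) - toFun N hp o (w n) e.1| with hb
  set d : (Σ x, ι x) → ℝ := fun e =>
    |toFun N hp o F (N e.1 e.2) - toFun N hp o F e.1| with hd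
  have hsb : ∀ n, Summable fun e => b n e ^ p := fun n => (w n).dirichletFinite
  have hsd : Summable fun e => d e ^ p := F.dirichletFinite
  have hb0 : Tendsto (fun n => ∑' e, b n e ^ p) atTop (𝓝 0) := by
    have h1 := (tendsto_zero_iff_norm_tendsto_zero.1 hw).rpow_const (p := p) (Or.inr hp0.le)
    rw [Real.zero_rpow hp0.ne'] at h1
    exact squeeze_zero (fun n => dirichletSum_nonneg (N := N) _)
      (fun n => dirichletSum_le_dpNorm_rpow hp o) h1
  -- The gradient of `v n - F` is bounded by a fixed `ℓ^p` family `c + d` plus the gradient of `w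
  -- n`, which vanishes in `ℓ^p`.
  have habd : ∀ n e, a n e ≤ b n e + (c e + d e) := fun n e => by
    have h1 := hvw n e
    have h2 := abs_sub (toFun N hp o (v n) (N e.1 e.2) - toFun N hp o (v n) e.1)
      (toFun N hp o F (N e.1 e.2) - toFun N hp o F e.1)
    simp only [ha, hb, hd, map_sub, Pi.sub_apply]
    rw [sub_sub_sub_comm]
    linarith
  have ha0 : ∀ e, Tendsto (fun n => a n e) atTop (𝓝 0) := fun e => by
    have h1 := ((hv0 (N e.1 e.2)).sub (hv0 e.1)).abs
    rwa [sub_zero, abs_zero] at h1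
  have hD : Tendsto (fun n => dirichletSum N p (toFun N hp o (v n - F))) atTop (𝓝 0) :=
    tendsto_tsum_rpow_zero hp (fun _ _ => abs_nonneg _) (fun _ _ => abs_nonneg _)
      (fun e => add_nonneg (hc e) (abs_nonneg _)) hsb hb0
      (Real.summable_Lp_add_of_nonneg hp.le hc (fun _ => abs_nonneg _) hsc hsd) habd ha0
  have ho := ((hv0 o).abs.rpow_const (p := p) (Or.inr hp0.le))
  rw [abs_zero, Real.zero_rpow hp0.ne'] at ho
  have := (hD.add ho).rpow_const (p := 1 / p) (Or.inr (by positivity))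
  rw [add_zero, Real.zero_rpow (by positivity)] at this
  exact this

end DpSpace
end
end PHarmonic
-- Truncation, the closure of the finitely supported functions, and characters from ultrafilters
namespace PHarmonic

/-- Truncation of real numbers to `[-t, t]`. -/
noncomputable def clamp (t a : ℝ) : ℝ := max (min a t) (-t)

lemma abs_clamp_sub_clamp_le (t a b : ℝ) : |clamp t a - clamp t b| ≤ |a - b| := by
  refine (abs_max_sub_max_le_abs _ _ _).trans ((abs_min_sub_min_le_max _ _ _ _).trans ?_)
  simp

lemma abs_clamp_le {t : ℝ} (ht : 0 ≤ t) (a : ℝ) : |clamp t a| ≤ t :=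
  abs_le.2 ⟨le_max_right _ _, max_le (min_le_right _ _) (by linarith)⟩

lemma clamp_of_abs_le {t a : ℝ} (h : |a| ≤ t) : clamp t a = a := by
  obtain ⟨h1, h2⟩ := abs_le.1 h
  rw [clamp, min_eq_left h2, max_eq_left h1]

lemma abs_clamp_of_le_abs {t a : ℝ} (ht : 0 ≤ t) (h : t ≤ |a|) : |clamp t a| = t := by
  unfold clamp
  rcases le_abs.1 h with h | h
  · rw [min_eq_right h, max_eq_left (by linarith), abs_of_nonneg ht]
  · rw [min_eq_left (by linarith), max_eq_right (by linarith), abs_neg, abs_of_nonneg ht]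

lemma continuous_clamp (t : ℝ) : Continuous (clamp t) := by
  unfold clamp
  fun_prop

namespace DpSpace

variable {V : Type*} {ι : V → Type*} (N : ∀ x, ι x → V) {p : ℝ} (hp : 1 < p) (o : V)

/-- The finitely supported functions in `D_p`. -/
noncomputable def finSupp : Submodule ℝ (DpSpace N hp o) where
  carrier := {u | (Function.support (toFun N hp o u)).Finite}
  add_mem' {u v} hu hv := by
    rw [Set.mem_ofPred_eq, map_add]
    exact (Set.Finite.union hu hv).subset (Function.support_add _ _)
  zero_mem' := by
    rw [Set.mem_ofPred_eq, map_zero]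
    simp
  smul_mem' c u hu := by
    rw [Set.mem_ofPred_eq, map_smul]
    exact Set.Finite.subset hu (Function.support_const_smul_subset _ _)

variable {N hp o}

lemma mem_finSupp {u : DpSpace N hp o} :
    u ∈ finSupp N hp o ↔ (Function.support (toFun N hp o u)).Finite := Iff.rfl

/-- Bounded functions are dense in `D_p`. -/
lemma exists_tendsto_bounded (F : DpSpace N hp o) :
    ∃ v : ℕ → DpSpace N hp o, (∀ n, ∃ C, ∀ x, |toFun N hp o (v n) x| ≤ C) ∧
      Tendsto v atTop (𝓝 F) := by
  have hle : ∀ (n : ℕ) (x y : V), |clamp n (toFun N hp o F x) - clamp n (toFun N hp o F y)| ≤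
      1 * |toFun N hp o F x - toFun N hp o F y| := fun n x y => by
    rw [one_mul]
    exact abs_clamp_sub_clamp_le _ _ _
  refine ⟨fun n => mk N hp o (fun x => clamp n (toFun N hp o F x))
    (F.dirichletFinite.of_abs_sub_le hp (hle n)), fun n => ⟨n, fun x =>
      abs_clamp_le n.cast_nonneg _⟩, ?_⟩
  refine tendsto_of_pointwise (w := fun _ => 0) (fun _ => abs_nonneg _) F.dirichletFinite
    tendsto_const_nhds (fun x => ?_) fun n e => ?_
  · obtain ⟨m, hm⟩ := exists_nat_ge |toFun N hp o F x|
    refine tendsto_const_nhds.congr' ((eventually_ge_atTop m).mono fun n hn => ?_)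
    exact (clamp_of_abs_le (hm.trans (Nat.cast_le.2 hn))).symm
  · rw [map_zero]
    simpa using hle n (N e.1 e.2) e.1

/-- The function `a ↦ a - clamp t a` is Lipschitz. -/
lemma abs_sub_clamp_sub_le (t a b : ℝ) : |(a - clamp t a) - (b - clamp t b)| ≤ 2 * |a - b| := by
  have h1 := abs_clamp_sub_clamp_le t a b
  have h2 := abs_sub (a - b) (clamp t a - clamp t b)
  rw [sub_sub_sub_comm]
  linarith

/-- Soft thresholding of an element of `D_p`. -/
noncomputable def shrink (F : DpSpace N hp o) (t : ℝ) : DpSpace N hp o :=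
  mk N hp o (fun x => toFun N hp o F x - clamp t (toFun N hp o F x))
    (F.dirichletFinite.of_abs_sub_le hp fun _ _ => abs_sub_clamp_sub_le t _ _)

lemma shrink_apply (F : DpSpace N hp o) (t : ℝ) (x : V) :
    toFun N hp o (shrink F t) x = toFun N hp o F x - clamp t (toFun N hp o F x) := rfl

/-- The pointwise error is at most the threshold, and all gradients are dominated by twice that of
`F`. -/
lemma tendsto_shrink (F : DpSpace N hp o) :
    Tendsto (fun n : ℕ => shrink F (1 / ((n : ℝ) + 1))) atTop (𝓝 F) := by
  refine tendsto_of_pointwise (w := fun _ => 0)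
    (c := fun e => 2 * |toFun N hp o F (N e.1 e.2) - toFun N hp o F e.1|)
    (fun _ => by positivity) ?_
    tendsto_const_nhds (fun x => ?_) fun n e => ?_
  · simp only [Real.mul_rpow zero_le_two (abs_nonneg _)]
    exact F.dirichletFinite.mul_left _
  · have h1 : Tendsto (fun n : ℕ => clamp (1 / ((n : ℝ) + 1)) (toFun N hp o F x)) atTop (𝓝 0) :=
      squeeze_zero_norm (fun n => abs_clamp_le (by positivity) _)
        tendsto_one_div_add_atTop_nhds_zero_nat
    have h2 := h1.const_sub (toFun N hp o F x)
    rwa [sub_zero] at h2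
  · rw [map_zero]
    simpa [shrink_apply] using abs_sub_clamp_sub_le ((n : ℝ) + 1)⁻¹
      (toFun N hp o F (N e.1 e.2)) (toFun N hp o F e.1)

/-- An `ℓ^p` function exceeds any positive threshold at only finitely many points, so its soft
thresholds are finitely supported. -/
lemma mem_closure_finSupp_of_summable {F : DpSpace N hp o}
    (hF : Summable fun x => |toFun N hp o F x| ^ p) :
    F ∈ (finSupp N hp o).topologicalClosure := by
  have hp0 : 0 < p := by linarith
  refine mem_closure_of_tendsto (tendsto_shrink F) (Eventually.of_forall fun n => ?_)
  have ht : (0 : ℝ) < 1 / ((n : ℝ) + 1) := by positivity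
  have h1 := hF.tendsto_cofinite_zero.eventually (gt_mem_nhds (Real.rpow_pos_of_pos ht p))
  refine Set.Finite.subset (eventually_cofinite.1 h1) fun x hx hlt => hx ?_
  rw [shrink_apply, clamp_of_abs_le, sub_self]
  exact ((Real.rpow_lt_rpow_iff (abs_nonneg _) ht.le hp0).1 hlt).le

/-- The bounded functions in the closure of the finitely supported functions absorb
multiplication by bounded functions of `D_p`. -/
lemma mul_mem_closure_finSupp
    (hconn : ∀ x, Relation.ReflTransGen (fun x y => ∃ i, N x i = y) o x)
    {F P : DpSpace N hp o} (hF : F ∈ (finSupp N hp o).topologicalClosure)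
    {C H : ℝ} (hC : ∀ x, |toFun N hp o F x| ≤ C) {h : V → ℝ} (hh : DirichletFinite N p h)
    (hH : ∀ x, |h x| ≤ H) (hP : toFun N hp o P = toFun N hp o F * h) :
    P ∈ (finSupp N hp o).topologicalClosure := by
  have hC0 : 0 ≤ C := (abs_nonneg _).trans (hC o)
  have hH0 : 0 ≤ H := (abs_nonneg _).trans (hH o)
  obtain ⟨u, hu, hlim⟩ := mem_closure_iff_seq_limit.1 hF
  have hcl : ∀ n, DirichletFinite N p fun x => clamp C (toFun N hp o (u n) x) := fun n =>
    (u n).dirichletFinite.of_abs_sub_le hp (L := 1) fun x y => by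
      rw [one_mul]
      exact abs_clamp_sub_clamp_le _ _ _
  set f := toFun N hp o F with hf
  -- Truncating `u n` at the bound `C` of `F` does not change the limit, but gives the uniform bound
  -- needed to control the gradient of the product with `h`.
  refine mem_closure_of_tendsto (f := fun n => mk N hp o _
    ((hcl n).mul hp hh (fun x => abs_clamp_le hC0 _) hH)) (b := atTop) ?_
    (Eventually.of_forall fun n => ?_)
  · refine tendsto_of_pointwise (w := fun n => H • (u n - F))
      (c := fun e => H * |f (N e.1 e.2) - f e.1| + C * |h (N e.1 e.2) - h e.1|)
      (fun _ => by positivity) ?_ ?_ (fun x => ?_) fun n e => ?_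
    · refine Real.summable_Lp_add_of_nonneg hp.le (fun _ => by positivity)
        (fun _ => by positivity) ?_ ?_
      · simp only [Real.mul_rpow hH0 (abs_nonneg _)]
        exact F.dirichletFinite.mul_left _
      · simp only [Real.mul_rpow hC0 (abs_nonneg _)]
        exact hh.mul_left _
    · simpa using (hlim.sub_const F).const_smul H
    · have h1 := ((continuous_clamp C).tendsto _).comp (tendsto_apply hlim (hconn x))
      rw [clamp_of_abs_le (hC x)] at h1
      rw [hP]
      exact h1.mul_const (h x)
    · set g := toFun N hp o (u n) with hg
      simp only [toFun_mk, map_smul, map_sub, Pi.smul_apply, Pi.sub_apply, Pi.mul_apply,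
        smul_eq_mul, ← hf, ← hg]
      set x := e.1
      set y := N x e.2
      have e1 : clamp C (g y) * h y - clamp C (g x) * h x =
          (clamp C (g y) - clamp C (g x)) * h y + clamp C (g x) * (h y - h x) := by ring
      have e2 : H * (g y - f y) - H * (g x - f x) = H * ((g y - g x) - (f y - f x)) := by ring
      rw [e1, e2, abs_mul, abs_of_nonneg hH0]
      refine (abs_add_le _ _).trans ?_
      rw [abs_mul, abs_mul, ← add_assoc, ← mul_add]
      refine add_le_add ?_ (mul_le_mul_of_nonneg_right (abs_clamp_le hC0 _) (abs_nonneg _))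
      rw [mul_comm]
      refine mul_le_mul (hH y) ((abs_clamp_sub_clamp_le _ _ _).trans ?_) (abs_nonneg _) hH0
      have := abs_add_le ((g y - g x) - (f y - f x)) (f y - f x)
      rwa [sub_add_cancel] at this
  · refine Set.Finite.subset (hu n) fun x hx hx0 => hx ?_
    have : clamp C (toFun N hp o (u n) x) = 0 := by
      rw [show toFun N hp o (u n) x = 0 from hx0]
      exact clamp_of_abs_le (by simpa using hC0)
    change clamp C (toFun N hp o (u n) x) * h x = 0
    rw [this, zero_mul]

end DpSpace

/-- An ideal of `BD_p` which is proper is annihilated by a character that is a limit along an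
ultrafilter. -/
lemma exists_character {V : Type*} {ι : V → Type*} {N : ∀ x, ι x → V} {p : ℝ} {hp : 1 < p}
    (J : Ideal (BDp N hp)) (hJ : J ≠ ⊤) :
    ∃ (U : Ultrafilter V) (τ : BDp N hp →ₐ[ℝ] ℂ),
      (∀ f ∈ J, Tendsto f.1 U (𝓝 0)) ∧
      ∀ f, ∃ a : ℝ, Tendsto f.1 U (𝓝 a) ∧ τ f = a := by
  -- A function bounded away from zero is invertible in `BD_p`, hence lies in no proper ideal.
  have hinv : ∀ f ∈ J, ∀ δ > 0, ∃ x, |f.1 x| < δ := by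
    intro f hf δ hδ
    by_contra! hcon
    have hne : ∀ x, f.1 x ≠ 0 := fun x h0 => by
      have := hcon x
      rw [h0, abs_zero] at this
      linarith
    have hg : (fun x => (f.1 x)⁻¹) ∈ BDp N hp := by
      refine ⟨f.2.1.of_abs_sub_le hp (L := (δ * δ)⁻¹) fun x y => ?_, δ⁻¹, fun x => ?_⟩
      · rw [inv_sub_inv (hne x) (hne y), abs_div, abs_mul, abs_sub_comm, div_eq_mul_inv, mul_comm]
        exact mul_le_mul_of_nonneg_right (inv_anti₀ (by positivity)
          (mul_le_mul (hcon x) (hcon y) hδ.le (abs_nonneg _))) (abs_nonneg _)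
      · rw [abs_inv]
        exact inv_anti₀ hδ (hcon x)
    refine hJ ((Ideal.eq_top_iff_one J).2 ?_)
    have : (⟨_, hg⟩ : BDp N hp) * f = 1 := Subtype.ext (funext fun x => inv_mul_cancel₀ (hne x))
    rw [← this]
    exact J.mul_mem_left _ hf
  let S : {q : BDp N hp × ℝ // q.1 ∈ J ∧ 0 < q.2} → Set V := fun q => {x | |q.1.1.1 x| < q.1.2}
  have : Nonempty {q : BDp N hp × ℝ // q.1 ∈ J ∧ 0 < q.2} := ⟨⟨(0, 1), J.zero_mem, one_pos⟩⟩
  -- Smallness of `f² + g²` forces smallness of both `f` and `g`, so the sets `S q` generate a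
  -- proper filter.
  have hdir : Directed (· ≥ ·) fun q => 𝓟 (S q) := by
    rintro ⟨⟨f, δ⟩, hf, hδ : 0 < δ⟩ ⟨⟨g, ε⟩, hg, hε : 0 < ε⟩
    refine ⟨⟨(f * f + g * g, min (δ ^ 2) (ε ^ 2)),
      J.add_mem (J.mul_mem_left _ hf) (J.mul_mem_left _ hg), lt_min (by positivity) (by positivity)⟩,
      principal_mono.2 fun x hx => ?_, principal_mono.2 fun x hx => ?_⟩
    all_goals
      have hx' : |f.1 x * f.1 x + g.1 x * g.1 x| < min (δ ^ 2) (ε ^ 2) := hx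
      have h1 := (le_abs_self _).trans_lt (hx'.trans_le (min_le_left _ _))
      have h2 := (le_abs_self _).trans_lt (hx'.trans_le (min_le_right _ _))
    · exact abs_lt_of_sq_lt_sq (by nlinarith [mul_self_nonneg (g.1 x)]) hδ.le
    · exact abs_lt_of_sq_lt_sq (by nlinarith [mul_self_nonneg (f.1 x)]) hε.le
  have hbot : (⨅ q, 𝓟 (S q)).NeBot := iInf_neBot_of_directed' hdir fun q =>
    principal_neBot_iff.2 (hinv q.1.1 q.2.1 q.1.2 q.2.2)
  let U : Ultrafilter V := Ultrafilter.of (⨅ q, 𝓟 (S q))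
  have hlim : ∀ f : BDp N hp, ∃ a : ℝ, Tendsto f.1 U (𝓝 a) := by
    rintro ⟨f, -, C, hC⟩
    obtain ⟨a, -, ha⟩ := (isCompact_Icc (a := -C) (b := C)).ultrafilter_le_nhds (U.map f)
      (le_principal_iff.2 (mem_map.2 (Eventually.of_forall fun x : V => abs_le.1 (hC x))))
    exact ⟨a, ha⟩
  choose L hL using hlim
  let τ : BDp N hp →ₐ[ℝ] ℝ :=
    { toFun := L
      map_one' := tendsto_nhds_unique (hL 1) tendsto_const_nhds
      map_mul' := fun f g => tendsto_nhds_unique (hL (f * g)) ((hL f).mul (hL g))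
      map_zero' := tendsto_nhds_unique (hL 0) tendsto_const_nhds
      map_add' := fun f g => tendsto_nhds_unique (hL (f + g)) ((hL f).add (hL g))
      commutes' := fun c => tendsto_nhds_unique (hL (algebraMap ℝ _ c)) tendsto_const_nhds }
  refine ⟨U, Complex.ofRealAm.comp τ, fun f hf => ?_, fun f => ⟨L f, hL f, rfl⟩⟩
  refine Metric.tendsto_nhds.2 fun δ hδ => ?_
  have h1 : S ⟨(f, δ), hf, hδ⟩ ∈ U :=
    Ultrafilter.of_le _ (mem_iInf_of_mem ⟨(f, δ), hf, hδ⟩ (mem_principal_self _))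
  filter_upwards [h1] with x hx
  simpa [S] using hx

end PHarmonic
-- The harmonic boundary of a locally finite connected graph
namespace PHarmonic
section Graph

variable {V : Type*} (G : SimpleGraph V) {p : ℝ} (hp : 1 < p) (o : V)

/-- Only the finitely many edges at `x` contribute. -/
lemma dirichletFinite_indicator_singleton (hp : 1 < p) (hG : ∀ x, (G.neighborSet x).Finite)
    (x : V) : DirichletFinite (graphNbr G) p (Set.indicator {x} 1) := by
  have hp0 : p ≠ 0 := by linarith
  refine summable_of_hasFiniteSupport ?_
  have hinj : Function.Injective fun e : Σ z, G.neighborSet z => (e.1, e.2.1) := by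
    rintro ⟨a, b, hb⟩ ⟨c, d, hd⟩ h
    obtain ⟨rfl, rfl⟩ := Prod.mk.inj h
    rfl
  refine Set.Finite.of_finite_image (f := fun e : Σ z, G.neighborSet z => (e.1, e.2.1))
    (Set.Finite.subset (((Set.finite_singleton x).prod (hG x)).union
      ((hG x).prod (Set.finite_singleton x))) ?_) hinj.injOn
  rintro _ ⟨⟨a, b, hb⟩, he, rfl⟩
  by_cases ha : a = x
  · subst ha
    exact Or.inl ⟨rfl, hb⟩
  · by_cases hbx : b = x
    · subst hbx
      exact Or.inr ⟨G.adj_symm hb, rfl⟩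
    · refine absurd ?_ he
      simp [energyTerm, graphNbr, ha, hbx, Real.zero_rpow hp0]

/-- The element of `D_p` given by an element of `BD_p`. -/
def toDp {G : SimpleGraph V} {hp : 1 < p} (o : V) (f : BDp (graphNbr G) hp) :
    DpSpace (graphNbr G) hp o :=
  DpSpace.mk (graphNbr G) hp o f.1 f.2.1

lemma mem_boundedFinSuppClosure {f : BDp (graphNbr G) hp} :
    f ∈ boundedFinSuppClosure G hp o ↔
      toDp o f ∈ (DpSpace.finSupp (graphNbr G) hp o).topologicalClosure := by
  constructor
  · rintro ⟨u, hu, huf⟩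
    have : u = toDp o f := DpSpace.toFun_injective huf
    exact this ▸ hu
  · exact fun h => ⟨_, h, rfl⟩

/-- The bounded functions in the closure of the finitely supported functions, as an ideal. -/
noncomputable def boundedFinSuppIdeal
    (hconn : ∀ x, Relation.ReflTransGen (fun x y => ∃ i, graphNbr G x i = y) o x) :
    Ideal (BDp (graphNbr G) hp) where
  carrier := boundedFinSuppClosure G hp o
  add_mem' {f g} hf hg := by
    rw [mem_boundedFinSuppClosure] at *
    exact add_mem hf hg
  zero_mem' := (mem_boundedFinSuppClosure G hp o).2 (zero_mem _)
  smul_mem' h f hf := by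
    rw [mem_boundedFinSuppClosure] at *
    obtain ⟨C, hC⟩ := f.2.2
    obtain ⟨H, hH⟩ := h.2.2
    exact DpSpace.mul_mem_closure_finSupp hconn hf hC h.2.1 hH (mul_comm h.1 f.1)

lemma mem_boundedFinSuppIdeal
    (hconn : ∀ x, Relation.ReflTransGen (fun x y => ∃ i, graphNbr G x i = y) o x)
    {f : BDp (graphNbr G) hp} : f ∈ boundedFinSuppIdeal G hp o hconn ↔
      toDp o f ∈ (DpSpace.finSupp (graphNbr G) hp o).topologicalClosure :=
  mem_boundedFinSuppClosure G hp o

/-- A character that annihilates the bounded functions in the closure of the finitely supported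
functions is not an evaluation at a vertex. -/
lemma mem_harmonicBoundary (hG : ∀ x, (G.neighborSet x).Finite) {τ : Spectrum G hp}
    (hτ : ∀ f ∈ boundedFinSuppClosure G hp o, τ f = 0) : τ ∈ harmonicBoundary G hp o := by
  refine ⟨?_, hτ⟩
  rintro ⟨x, rfl⟩
  have hmem : Set.indicator {x} 1 ∈ BDp (graphNbr G) hp :=
    ⟨dirichletFinite_indicator_singleton G hp hG x, 1, fun y => by
      by_cases hy : y = x <;> simp [hy]⟩
  have h1 := hτ ⟨_, hmem⟩ ((mem_boundedFinSuppClosure G hp o).2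
    (Submodule.le_topologicalClosure _ (DpSpace.mem_finSupp.2
      ((Set.finite_singleton x).subset Set.support_indicator_subset))))
  have h2 : ((Set.indicator {x} 1 x : ℝ) : ℂ) = 0 := h1
  simp at h2

/-- The closure of the finitely supported functions, together with the constant functions. -/
noncomputable def finSuppSupConst : Submodule ℝ (DpSpace (graphNbr G) hp o) :=
  (DpSpace.finSupp (graphNbr G) hp o).topologicalClosure ⊔
    Submodule.span ℝ {toDp o (1 : BDp (graphNbr G) hp)}

/-- The constants are one-dimensional, so adding them to a closed subspace requires no further
closure. -/
lemma isClosed_finSuppSupConst :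
    IsClosed (finSuppSupConst G hp o : Set (DpSpace (graphNbr G) hp o)) :=
  Submodule.isClosed_sup_finiteDimensional _ _ (Submodule.isClosed_topologicalClosure _)

variable {G hp o}

lemma toDp_mem_finSuppSupConst {f : BDp (graphNbr G) hp} {c : ℝ}
    (h : toDp o (f - algebraMap ℝ _ c) ∈
      (DpSpace.finSupp (graphNbr G) hp o).topologicalClosure) :
    toDp o f ∈ finSuppSupConst G hp o := by
  refine Submodule.mem_sup.2 ⟨_, h, c • toDp o 1,
    Submodule.smul_mem _ _ (Submodule.mem_span_singleton_self _), ?_⟩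
  refine DpSpace.toFun_injective (funext fun x => ?_)
  change (f.1 x - c) + c * 1 = f.1 x
  ring

lemma encard_harmonicBoundary_le_one (h : finSuppSupConst G hp o = ⊤) :
    (harmonicBoundary G hp o).encard ≤ 1 := by
  have key : ∀ f : BDp (graphNbr G) hp, ∃ c : ℝ, ∀ τ ∈ harmonicBoundary G hp o, τ f = c := by
    intro f
    have hf : toDp o f ∈ finSuppSupConst G hp o := h ▸ Submodule.mem_top
    obtain ⟨g, hg, k, hk, hgk⟩ := Submodule.mem_sup.1 hf
    obtain ⟨c, rfl⟩ := Submodule.mem_span_singleton.1 hk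
    refine ⟨c, fun τ hτ => ?_⟩
    have hB : f - algebraMap ℝ _ c ∈ boundedFinSuppClosure G hp o := by
      refine ⟨g, hg, funext fun x => ?_⟩
      have h1 := congrFun (congrArg (DpSpace.toFun _ hp o) hgk) x
      have h2 : DpSpace.toFun _ hp o g x + c * 1 = f.1 x := h1
      change _ = f.1 x - c
      linarith
    have h3 := hτ.2 _ hB
    rw [map_sub, AlgHom.commutes, sub_eq_zero] at h3
    exact h3
  refine Set.encard_le_one_iff.2 fun τ σ hτ hσ => AlgHom.ext fun f => ?_
  obtain ⟨c, hc⟩ := key f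
  rw [hc τ hτ, hc σ hσ]

lemma one_lt_encard_harmonicBoundary (hG : ∀ x, (G.neighborSet x).Finite)
    (hconn : ∀ x, Relation.ReflTransGen (fun x y => ∃ i, graphNbr G x i = y) o x)
    (h : finSuppSupConst G hp o ≠ ⊤) : 1 < (harmonicBoundary G hp o).encard := by
  obtain ⟨f, hf⟩ : ∃ f : BDp (graphNbr G) hp, toDp o f ∉ finSuppSupConst G hp o := by
    by_contra! hall
    refine h (eq_top_iff.2 fun F _ => ?_)
    obtain ⟨v, hv, hlim⟩ := DpSpace.exists_tendsto_bounded F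
    exact (isClosed_finSuppSupConst G hp o).mem_of_tendsto hlim
      (Eventually.of_forall fun n => hall ⟨_, (v n).dirichletFinite, hv n⟩)
  set B := boundedFinSuppIdeal G hp o hconn with hB
  have hB1 : B ≠ ⊤ := fun htop => hf (Submodule.mem_sup_left
    ((mem_boundedFinSuppIdeal G hp o hconn).1 (hB ▸ htop ▸ Submodule.mem_top)))
  obtain ⟨U₀, τ₀, hU₀, hτ₀⟩ := exists_character B hB1
  obtain ⟨c, -, hc⟩ := hτ₀ f
  set g := f - algebraMap ℝ _ c with hg
  have hgc : τ₀ g = 0 := by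
    rw [hg, map_sub, AlgHom.commutes, hc]
    exact sub_self _
  have hgD : toDp o g ∉ (DpSpace.finSupp (graphNbr G) hp o).topologicalClosure :=
    fun hmem => hf (toDp_mem_finSuppSupConst hmem)
  obtain ⟨t, ht, hs⟩ : ∃ t : ℝ, 0 < t ∧
      (toDp o g).shrink t ∉ (DpSpace.finSupp (graphNbr G) hp o).topologicalClosure := by
    by_contra! hall
    exact hgD ((Submodule.isClosed_topologicalClosure _).mem_of_tendsto
      (DpSpace.tendsto_shrink _) (Eventually.of_forall fun n => hall _ (by positivity)))
  obtain ⟨C, hC⟩ := g.2.2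
  let s : BDp (graphNbr G) hp := ⟨fun x => g.1 x - clamp t (g.1 x),
    ((toDp o g).shrink t).dirichletFinite, C + t, fun x =>
      (abs_sub _ _).trans (add_le_add (hC x) (abs_clamp_le ht.le _))⟩
  -- `k` vanishes where `|g| ≥ t`, while `s` vanishes where `|g| ≤ t`; moreover `k = 1` where `g =
  -- 0`.
  let k : BDp (graphNbr G) hp := ⟨fun x => 1 - t⁻¹ * |clamp t (g.1 x)|,
    g.2.1.of_abs_sub_le hp (L := t⁻¹) fun x y => by
      rw [sub_sub_sub_cancel_left, ← mul_sub, abs_mul, abs_of_pos (inv_pos.2 ht), abs_sub_comm]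
      exact mul_le_mul_of_nonneg_left ((abs_abs_sub_abs_le _ _).trans
        (abs_clamp_sub_clamp_le _ _ _)) (inv_pos.2 ht).le,
    1 + t⁻¹ * t, fun x => by
      refine (abs_sub _ _).trans ?_
      rw [abs_one, abs_mul, abs_of_pos (inv_pos.2 ht), abs_abs]
      gcongr
      exact abs_clamp_le ht.le _⟩
  have hks : k * s = 0 := by
    refine Subtype.ext (funext fun x => ?_)
    change (1 - t⁻¹ * |clamp t (g.1 x)|) * (g.1 x - clamp t (g.1 x)) = 0
    rcases le_total |g.1 x| t with hx | hx
    · rw [clamp_of_abs_le hx, sub_self, mul_zero]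
    · rw [abs_clamp_of_le_abs ht.le hx, inv_mul_cancel₀ ht.ne', sub_self, zero_mul]
  have hJ : B ⊔ Ideal.span {k} ≠ ⊤ := by
    intro htop
    obtain ⟨b, hb, l, hl, hbl⟩ := Submodule.mem_sup.1 ((Ideal.eq_top_iff_one _).1 htop)
    obtain ⟨a, rfl⟩ := Ideal.mem_span_singleton'.1 hl
    have hsb : s = s * b := by
      calc s = (b + a * k) * s := by rw [hbl, one_mul]
        _ = s * b + a * (k * s) := by ring
        _ = s * b := by rw [hks, mul_zero, add_zero]
    have : s ∈ B := hsb ▸ B.mul_mem_left s hb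
    exact hs ((mem_boundedFinSuppIdeal G hp o hconn).1 this)
  obtain ⟨U₁, τ₁, hU₁, hτ₁⟩ := exists_character _ hJ
  -- An ultrafilter character built from an ideal containing `B` kills `B`, since limits are unique.
  have hkill : ∀ {U : Ultrafilter V} {τ : BDp (graphNbr G) hp →ₐ[ℝ] ℂ}
      {J : Ideal (BDp (graphNbr G) hp)}, B ≤ J → (∀ f ∈ J, Tendsto f.1 U (𝓝 0)) →
      (∀ f, ∃ a : ℝ, Tendsto f.1 U (𝓝 a) ∧ τ f = a) → τ ∈ harmonicBoundary G hp o := by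
    intro U τ J hBJ hU hτ
    refine mem_harmonicBoundary G hp o hG fun f hf => ?_
    obtain ⟨a, ha, hfa⟩ := hτ f
    rw [hfa, tendsto_nhds_unique ha (hU f (hBJ hf)), Complex.ofReal_zero]
  refine Set.one_lt_encard_iff.2 ⟨τ₀, τ₁, hkill le_rfl hU₀ hτ₀, hkill le_sup_left hU₁ hτ₁, ?_⟩
  -- If the characters agreed, `g` would tend to `0` along `U₁`, hence `k` to `1`, although `k` lies
  -- in the ideal whose elements tend to `0`.
  rintro rfl
  obtain ⟨a, ha, hga⟩ := hτ₁ g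
  rw [hgc, eq_comm, Complex.ofReal_eq_zero] at hga
  rw [hga] at ha
  have h1 := (((continuous_clamp t).tendsto 0).comp ha).abs.const_mul t⁻¹ |>.const_sub 1
  rw [clamp_of_abs_le (by simpa using ht.le), abs_zero, mul_zero, sub_zero] at h1
  have h2 : Tendsto k.1 U₁ (𝓝 0) := hU₁ k (Submodule.mem_sup_right (Ideal.mem_span_singleton_self k))
  exact one_ne_zero (tendsto_nhds_unique h1 h2)

end Graph
end PHarmonic
-- Comparison of the group with its Cayley graph
namespace PHarmonic
section Cayley

lemma tsum_le_tsum_of_injective {α β : Type*} {u : α → ℝ} {v : β → ℝ} {s : ℝ} (hv : HasSum v s)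
    (hv0 : ∀ b, 0 ≤ v b) {ψ : α → β} (hψ : Function.Injective ψ) (h : ∀ a, u a = v (ψ a)) :
    Summable u ∧ ∑' a, u a ≤ s := by
  obtain rfl : u = v ∘ ψ := funext h
  have hs := hv.summable.comp_injective hψ
  exact ⟨hs, hv.tsum_eq ▸ hs.tsum_le_tsum_of_inj ψ hψ (fun c _ => hv0 c) (fun _ => le_rfl)
    hv.summable⟩

variable {Γ : Type*} [Group Γ] {S : Set Γ} {p : ℝ}

lemma dirichletSum_groupNbr_le (hp : 1 < p) {f : Γ → ℝ}
    (hf : DirichletFinite (graphNbr (SimpleGraph.mulCayley S)) p f) :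
    DirichletFinite (groupNbr S) p f ∧ dirichletSum (groupNbr S) p f ≤
      dirichletSum (graphNbr (SimpleGraph.mulCayley S)) p f := by
  classical
  have hp0 : p ≠ 0 := by linarith
  have hadj : ∀ e : Σ _ : Γ, S, ¬ (e.2 : Γ) = 1 →
      (SimpleGraph.mulCayley S).Adj e.1 (e.1 * (e.2 : Γ)⁻¹) := fun e he => by
    rw [SimpleGraph.mulCayley_adj]
    exact ⟨by simpa using he, Or.inr (by simp)⟩
  have hsum := HasSum.sum
    (f := Sum.elim (energyTerm (graphNbr (SimpleGraph.mulCayley S)) p f) (fun _ : Γ => 0))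
    hf.hasSum hasSum_zero
  rw [add_zero] at hsum
  -- A pair `(x, s)` with `s ≠ 1` is a directed edge. If `s = 1` there is no edge and the term is
  -- zero; such pairs go to an extra copy of `Γ` carrying zeros.
  refine tsum_le_tsum_of_injective (v := Sum.elim
      (energyTerm (graphNbr (SimpleGraph.mulCayley S)) p f) (fun _ : Γ => 0))
    (ψ := fun e => if he : (e.2 : Γ) = 1 then Sum.inr e.1 else
      Sum.inl ⟨e.1, ⟨e.1 * (e.2 : Γ)⁻¹, hadj e he⟩⟩)
    hsum ?_ ?_ ?_
  · rintro (e | _)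
    · exact energyTerm_nonneg _ _
    · exact le_rfl
  · rintro ⟨x, s, hs⟩ ⟨y, t, ht⟩ h
    by_cases h1 : s = 1 <;> by_cases h2 : t = 1 <;> simp only [h1, h2, dite_true, dite_false] at h
    · obtain rfl := Sum.inr_injective h
      subst h1 h2
      rfl
    · exact absurd h (by simp)
    · exact absurd h (by simp)
    · have h3 := congrArg (fun e : Σ z, (SimpleGraph.mulCayley S).neighborSet z => (e.1, e.2.1))
        (Sum.inl_injective h)
      obtain ⟨rfl, h4⟩ := Prod.mk.inj h3
      obtain rfl := inv_injective (mul_left_cancel h4)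
      rfl
  · rintro ⟨x, s, hs⟩
    by_cases h1 : s = 1
    · simp [h1, energyTerm, groupNbr, Real.zero_rpow hp0]
    · simp [h1, energyTerm, groupNbr, graphNbr]

lemma dirichletSum_graphNbr_le {f : Γ → ℝ} (hf : DirichletFinite (groupNbr S) p f) :
    DirichletFinite (graphNbr (SimpleGraph.mulCayley S)) p f ∧
      dirichletSum (graphNbr (SimpleGraph.mulCayley S)) p f ≤
        dirichletSum (groupNbr S) p f + dirichletSum (groupNbr S) p f := by
  classical
  have hadj : ∀ e : Σ x, (SimpleGraph.mulCayley S).neighborSet x,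
      ¬ (e.2.1⁻¹ * e.1 ∈ S) → e.1⁻¹ * e.2.1 ∈ S := fun e he =>
    ((SimpleGraph.mulCayley_adj S _ _).1 e.2.2).2.resolve_right he
  -- Both directions of an edge may come from the same pair `(x, s)`, namely if `s⁻¹ ∉ S`. Two
  -- copies of the index set keep the map injective, whence the factor 2.
  refine tsum_le_tsum_of_injective
    (v := Sum.elim (energyTerm (groupNbr S) p f) (energyTerm (groupNbr S) p f))
    (ψ := fun e => if he : e.2.1⁻¹ * e.1 ∈ S then Sum.inl ⟨e.1, ⟨_, he⟩⟩ else
      Sum.inr ⟨e.2.1, ⟨_, hadj e he⟩⟩)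
    (HasSum.sum hf.hasSum hf.hasSum) ?_ ?_ ?_
  · rintro (e | e) <;> exact energyTerm_nonneg _ _
  · rintro ⟨x, y, hy⟩ ⟨z, w, hw⟩ h
    by_cases h1 : y⁻¹ * x ∈ S <;> by_cases h2 : w⁻¹ * z ∈ S <;>
      simp only [h1, h2, dite_true, dite_false] at h
    · have h3 := congrArg (fun e : Σ _ : Γ, S => (e.1, (e.2 : Γ))) (Sum.inl_injective h)
      obtain ⟨rfl, h4⟩ := Prod.mk.inj h3
      obtain rfl := inv_injective (mul_right_cancel h4)
      rfl
    · exact absurd h (by simp)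
    · exact absurd h (by simp)
    · have h3 := congrArg (fun e : Σ _ : Γ, S => (e.1, (e.2 : Γ))) (Sum.inr_injective h)
      obtain ⟨rfl, h4⟩ := Prod.mk.inj h3
      obtain rfl := inv_injective (mul_right_cancel h4)
      rfl
  · rintro ⟨x, y, hy⟩
    by_cases h1 : y⁻¹ * x ∈ S
    · simp [h1, energyTerm, groupNbr, graphNbr]
    · simp [h1, energyTerm, groupNbr, graphNbr, abs_sub_comm]

lemma finite_neighborSet_mulCayley (hS : S.Finite) (x : Γ) :
    ((SimpleGraph.mulCayley S).neighborSet x).Finite := by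
  refine Set.Finite.subset ((hS.image fun s => x * s).union (hS.image fun s => x * s⁻¹)) fun y hy => ?_
  rcases ((SimpleGraph.mulCayley_adj S _ _).1 hy).2 with h | h
  · exact Or.inl ⟨_, h, by simp⟩
  · exact Or.inr ⟨_, h, by simp⟩

lemma reflTransGen_mulCayley (hgen : Subgroup.closure S = ⊤) (x : Γ) :
    Relation.ReflTransGen
      (fun x y => ∃ i, graphNbr (SimpleGraph.mulCayley S) x i = y) 1 x := by
  have hstep : ∀ a b : Γ, a⁻¹ * b ∈ S ∨ b⁻¹ * a ∈ S → Relation.ReflTransGen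
      (fun x y => ∃ i, graphNbr (SimpleGraph.mulCayley S) x i = y) a b := fun a b h => by
    -- The identity may belong to `S`, and it gives no edge.
    by_cases hab : a = b
    · rw [hab]
    · exact .single ⟨⟨b, (SimpleGraph.mulCayley_adj S _ _).2 ⟨hab, h⟩⟩, rfl⟩
  have hx : x ∈ Subgroup.closure S := hgen ▸ Subgroup.mem_top x
  induction hx using Subgroup.closure_induction_right with
  | one => exact .refl
  | mul_right x _ y hy ih => exact ih.trans (hstep _ _ (Or.inl (by simpa using hy)))
  | mul_inv_cancel x _ y hy ih => exact ih.trans (hstep _ _ (Or.inr (by simpa using hy)))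

variable (S) (hp : 1 < p)

/-- The identity, as a map from `D_p` of the Cayley graph to `D_p` of the group. -/
noncomputable def graphToGroup :
    DpSpace (graphNbr (SimpleGraph.mulCayley S)) hp (1 : Γ) →L[ℝ] DpGroup S hp :=
  LinearMap.mkContinuous
    { toFun := fun F => DpSpace.mk _ hp 1 _ (dirichletSum_groupNbr_le hp F.dirichletFinite).1
      map_add' := fun _ _ => rfl
      map_smul' := fun _ _ => rfl } 1 fun F => by
    rw [one_mul]
    refine Real.rpow_le_rpow (add_nonneg (dirichletSum_nonneg _) (by positivity)) ?_ (by positivity)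
    exact add_le_add_left (dirichletSum_groupNbr_le hp F.dirichletFinite).2 _

/-- The identity, as a map from `D_p` of the group to `D_p` of the Cayley graph. -/
noncomputable def groupToGraph :
    DpGroup S hp →L[ℝ] DpSpace (graphNbr (SimpleGraph.mulCayley S)) hp (1 : Γ) :=
  LinearMap.mkContinuous
    { toFun := fun F => DpSpace.mk _ hp 1 _ (dirichletSum_graphNbr_le F.dirichletFinite).1
      map_add' := fun _ _ => rfl
      map_smul' := fun _ _ => rfl } (2 ^ (1 / p)) fun F => by
    have h0 := dirichletSum_nonneg (N := groupNbr S) (p := p) (DpSpace.toFun _ hp 1 F)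
    have h1 : 0 ≤ |DpSpace.toFun _ hp 1 F 1| ^ p := by positivity
    rw [DpSpace.norm_def, DpSpace.norm_def, dpNorm, dpNorm,
      ← Real.mul_rpow zero_le_two (add_nonneg h0 h1)]
    refine Real.rpow_le_rpow (add_nonneg (dirichletSum_nonneg _) (by positivity)) ?_ (by positivity)
    have h2 := (dirichletSum_graphNbr_le F.dirichletFinite).2
    exact (add_le_add_left h2 (|DpSpace.toFun _ hp 1 F 1| ^ p)).trans (by linarith)

/-- Finitely supported functions are in `ℓ^p`, and continuity extends this to their closure. -/
lemma graphToGroup_mem {F : DpSpace (graphNbr (SimpleGraph.mulCayley S)) hp (1 : Γ)}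
    (hF : F ∈ finSuppSupConst (SimpleGraph.mulCayley S) hp 1) :
    graphToGroup S hp F ∈ (lpSubmodule S hp ⊔ constSubmodule S hp).topologicalClosure := by
  revert F
  change finSuppSupConst (SimpleGraph.mulCayley S) hp 1 ≤
    (lpSubmodule S hp ⊔ constSubmodule S hp).topologicalClosure.comap
      (graphToGroup S hp).toLinearMap
  refine sup_le (Submodule.topologicalClosure_minimal _ (fun u hu => ?_) ?_)
    ((Submodule.span_singleton_le_iff_mem _ _).2 ?_)
  · refine Submodule.le_topologicalClosure _ (Submodule.mem_sup_left ?_)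
    exact (memℓp_zero hu).of_exponent_ge bot_le
  · exact (Submodule.isClosed_topologicalClosure _).preimage (graphToGroup S hp).continuous
  · refine Submodule.le_topologicalClosure _ (Submodule.mem_sup_right ?_)
    exact Submodule.mem_span_singleton_self (fun _ : Γ => (1 : ℝ))

/-- Since the target is closed, it suffices to treat `ℓ^p` functions, by soft thresholding, and
constants. -/
lemma groupToGraph_mem {F : DpGroup S hp}
    (hF : F ∈ (lpSubmodule S hp ⊔ constSubmodule S hp).topologicalClosure) :
    groupToGraph S hp F ∈ finSuppSupConst (SimpleGraph.mulCayley S) hp 1 := by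
  have hp0 : 0 < p := by linarith
  revert F
  change (lpSubmodule S hp ⊔ constSubmodule S hp).topologicalClosure ≤
    (finSuppSupConst (SimpleGraph.mulCayley S) hp 1).comap (groupToGraph S hp).toLinearMap
  refine Submodule.topologicalClosure_minimal _ (sup_le (fun F hF => ?_) fun F hF => ?_)
    ((isClosed_finSuppSupConst _ hp 1).preimage (groupToGraph S hp).continuous)
  · refine Submodule.mem_sup_left (DpSpace.mem_closure_finSupp_of_summable ?_)
    have h1 := (memℓp_gen_iff (by rwa [ENNReal.toReal_ofReal hp0.le])).1 hF
    simp only [ENNReal.toReal_ofReal hp0.le, Real.norm_eq_abs] at h1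
    exact h1
  · obtain ⟨c, hc⟩ := Submodule.mem_span_singleton.1 hF
    refine Submodule.mem_sup_right (Submodule.mem_span_singleton.2 ⟨c, ?_⟩)
    exact DpSpace.toFun_injective hc

end Cayley
end PHarmonic

theorem theorem2p8 {Γ : Type*} [Group Γ] [Infinite Γ] (S : Set Γ) (hS : S.Finite)
    (hgen : Subgroup.closure S = ⊤) (p : ℝ) (hp : 1 < p) :
    Nontrivial (PHarmonic.ReducedCohomology S hp) ↔
      1 < (PHarmonic.harmonicBoundary (SimpleGraph.mulCayley S) hp (1 : Γ)).encard := by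
  rw [Submodule.Quotient.nontrivial_iff]
  constructor
  · intro h
    refine PHarmonic.one_lt_encard_harmonicBoundary
      (PHarmonic.finite_neighborSet_mulCayley hS) (PHarmonic.reflTransGen_mulCayley hgen)
      fun htop => h (eq_top_iff.2 fun F _ => ?_)
    have hF : PHarmonic.groupToGraph S hp F ∈
        PHarmonic.finSuppSupConst (SimpleGraph.mulCayley S) hp 1 := htop ▸ Submodule.mem_top
    -- Both comparison maps are the identity on functions, so their composite at `F` is `F` by
    -- definition.
    exact PHarmonic.graphToGroup_mem S hp hF
  · intro h htop
    refine h.not_ge (PHarmonic.encard_harmonicBoundary_le_one (eq_top_iff.2 fun F _ => ?_))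
    have hF : PHarmonic.graphToGroup S hp F ∈
      (PHarmonic.lpSubmodule S hp ⊔ PHarmonic.constSubmodule S hp).topologicalClosure :=
      htop ▸ Submodule.mem_top
    exact PHarmonic.groupToGraph_mem S hp hF
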